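/- Let $\mu=(\mu_n)_{n\ge 0}$ be a strictly increasing sequence of natural numbers, and let $(\alpha_{n,k})_{n\ge k\ge 0}$ be non-zero real numbers such that, for every $k\ge 0$, the sequence $(\alpha_{n,k})_{n\ge k}$ converges in $\mathbb{R}$ (the limit may be $0$). Then there exists a $C^\infty$ function $f:\mathbb{R}\to\mathbb{R}$ with the following property. $(\ast)$ For every continuous function $h:\mathbb{R}\to\mathbb{R}$ with $h(0)=0$ and every compact set $K\subset\mathbb{R}$, there is a strictly increasing sequence $(\lambda_n)_{n\ge 0}$ of elements of $\{\mu_m : m\ge 0\}$ such that $$\sup_{x\in K}\left|\sum_{k=0}^{\lambda_n}\frac{f^{(k)}(0)}{k!}\,\alpha_{\lambda_n,k}\,x^{k+1}-h(x)\right|\longrightarrow 0\qquad\text{as } n\to\infty .$$ Let $C^\infty(\mathbb{R})$ be the space of real-valued smooth functions on $\mathbb{R}$ with the Fréchet topology given by the seminorms $p_n(f)=\sum_{k=0}^{n}\sup_{[-n,n]}|f^{(k)}|$, $n\ge 0$, and let $\mathcal{U}\subset C^\infty(\mathbb{R})$ be the set of all $f$ with property $(\ast)$. Then: 1. $\mathcal{U}$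 is the set of $\mu$-generalized universal series, that is, of all $f\in C^\infty(\mathbb{R})$ for which the functions $x\mapsto\sum_{k=0}^{\mu_n}\frac{f^{(k)}(0)}{k!}\alpha_{\mu_n,k}x^{k+1}$, $n\ge 0$, form a dense subset of the space of continuous functions $h:\mathbb{R}\to\mathbb{R}$ with $h(0)=0$, endowed with the topology of uniform convergence on compact sets; 2. $\mathcal{U}$ is a dense $G_\delta$ subset of $C^\infty(\mathbb{R})$; 3. $\mathcal{U}\cup\{0\}$ contains a dense linear subspace of $C^\infty(\mathbb{R})$; 4. $\mathcal{U}\cup\{0\}$ contains an infinite-dimensional closed linear subspace of $C^\infty(\mathbb{R})$. -/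

import Mathlib

open Filter Topology
open scoped ContDiff

noncomputable section

namespace GenFekete

/-- The real vector space of smooth (`C^∞`) functions `ℝ → ℝ`, as a subspace of all functions. -/
def smoothSubmodule : Submodule ℝ (ℝ → ℝ) where
  carrier := {f | ContDiff ℝ ∞ f}
  add_mem' {f g} hf hg := by
    simp only [Set.mem_ofPred_eq] at hf hg ⊢
    exact hf.add hg
  zero_mem' := by
    simp only [Set.mem_ofPred_eq]
    exact contDiff_const
  smul_mem' c f hf := by
    simp only [Set.mem_ofPred_eq] at hf ⊢
    exact contDiff_const.smul hf

/-- The space `C^∞(ℝ)`. It is a type of its own, so that it does not carry the topology of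
pointwise convergence of the function space; its topology is defined below. -/
def SmoothFun : Type := smoothSubmodule

instance : AddCommGroup SmoothFun := inferInstanceAs (AddCommGroup smoothSubmodule)

instance : Module ℝ SmoothFun := inferInstanceAs (Module ℝ smoothSubmodule)

instance : CoeFun SmoothFun (fun _ => ℝ → ℝ) := ⟨fun f => f.1⟩

theorem SmoothFun.contDiff (f : SmoothFun) : ContDiff ℝ ∞ f := f.2

theorem SmoothFun.continuous_iteratedDeriv (f : SmoothFun) (k : ℕ) :
    Continuous (iteratedDeriv k f) :=
  f.contDiff.continuous_iteratedDeriv k (by exact_mod_cast le_top)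

theorem SmoothFun.iteratedDeriv_add (f g : SmoothFun) (k : ℕ) (x : ℝ) :
    iteratedDeriv k (f + g : SmoothFun) x = iteratedDeriv k f x + iteratedDeriv k g x :=
  _root_.iteratedDeriv_add (f.contDiff.contDiffAt.of_le (by exact_mod_cast le_top))
    (g.contDiff.contDiffAt.of_le (by exact_mod_cast le_top))

theorem SmoothFun.iteratedDeriv_smul (c : ℝ) (f : SmoothFun) (k : ℕ) (x : ℝ) :
    iteratedDeriv k (c • f : SmoothFun) x = c * iteratedDeriv k f x :=
  iteratedDeriv_const_smul_field c f.1

/-- `sup_{x ∈ [-n, n]} |f^{(k)}(x)|`. -/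
def supDeriv (n k : ℕ) (f : SmoothFun) : ℝ :=
  ⨆ x : Set.Icc (-(n : ℝ)) n, |iteratedDeriv k f x|

theorem bddAbove_supDeriv (n k : ℕ) (f : SmoothFun) :
    BddAbove (Set.range fun x : Set.Icc (-(n : ℝ)) n => |iteratedDeriv k f x|) :=
  isCompact_range ((f.continuous_iteratedDeriv k).comp continuous_subtype_val).abs |>.bddAbove

theorem supDeriv_add_le (n k : ℕ) (f g : SmoothFun) :
    supDeriv n k (f + g) ≤ supDeriv n k f + supDeriv n k g := by
  have : Nonempty (Set.Icc (-(n : ℝ)) n) := ⟨⟨0, by simp⟩⟩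
  refine ciSup_le fun x => ?_
  rw [SmoothFun.iteratedDeriv_add]
  exact (abs_add_le _ _).trans
    (add_le_add (le_ciSup (bddAbove_supDeriv n k f) x) (le_ciSup (bddAbove_supDeriv n k g) x))

theorem supDeriv_smul (n k : ℕ) (c : ℝ) (f : SmoothFun) :
    supDeriv n k (c • f) = |c| * supDeriv n k f := by
  unfold supDeriv
  rw [Real.mul_iSup_of_nonneg (abs_nonneg c)]
  simp only [SmoothFun.iteratedDeriv_smul, abs_mul]

/-- The seminorm `p_n(f) = ∑_{k=0}^n sup_{[-n, n]} |f^{(k)}|` on `C^∞(ℝ)`. -/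
def smoothSeminorm (n : ℕ) : Seminorm ℝ SmoothFun :=
  Seminorm.of (fun f => ∑ k ∈ Finset.range (n + 1), supDeriv n k f)
    (fun f g => by
      rw [← Finset.sum_add_distrib]
      exact Finset.sum_le_sum fun k _ => supDeriv_add_le n k f g)
    (fun c f => by
      rw [Finset.mul_sum]
      exact Finset.sum_congr rfl fun k _ => supDeriv_smul n k c f)

/-- The family of seminorms that defines the topology of `C^∞(ℝ)`. -/
def smoothSeminormFamily : SeminormFamily ℝ SmoothFun ℕ := smoothSeminorm

/-- The Fréchet topology of `C^∞(ℝ)`, generated by the seminorms `p_n`. -/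
instance : TopologicalSpace SmoothFun := smoothSeminormFamily.moduleFilterBasis.topology

theorem withSeminorms_smoothSeminormFamily : WithSeminorms smoothSeminormFamily := ⟨rfl⟩

/-- `C_0(ℝ)`: the continuous functions `h : ℝ → ℝ` with `h 0 = 0`. As a subspace of `C(ℝ, ℝ)`
with its compact-open topology, it carries the topology of uniform convergence on compact sets. -/
def vanishingAtZero : Submodule ℝ C(ℝ, ℝ) where
  carrier := {h | h 0 = 0}
  add_mem' {f g} hf hg := by
    simp only [Set.mem_ofPred_eq] at hf hg ⊢
    simp [hf, hg]
  zero_mem' := by simp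
  smul_mem' c f hf := by
    simp only [Set.mem_ofPred_eq] at hf ⊢
    simp [hf]

/-- The Borel map `T_0`: the sequence of Taylor coefficients `f^{(k)}(0) / k!` of `f` at `0`. -/
def taylorCoeff (f : SmoothFun) (k : ℕ) : ℝ := iteratedDeriv k f 0 / (k.factorial : ℝ)

/-- The perturbed Taylor sum `∑_{k=0}^n (f^{(k)}(0) / k!) α_{n,k} x^{k+1}`. -/
def perturbedSum (α : ℕ → ℕ → ℝ) (f : SmoothFun) (n : ℕ) (x : ℝ) : ℝ :=
  ∑ k ∈ Finset.range (n + 1), taylorCoeff f k * α n k * x ^ (k + 1)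

/-- The perturbed Taylor sum as an element of `C_0(ℝ)`. -/
def perturbedSumC (α : ℕ → ℕ → ℝ) (f : SmoothFun) (n : ℕ) : vanishingAtZero :=
  ⟨⟨perturbedSum α f n, by unfold perturbedSum; fun_prop⟩, by
    change perturbedSum α f n 0 = 0
    simp [perturbedSum]⟩

/-- The set of smooth `f` such that for every continuous `h` with `h 0 = 0` and every compact
`K` some increasing sequence `lam` of members of `μ` makes the perturbed Taylor sums of index
`lam n` converge to `h` uniformly on `K`. -/
def feketeUniversal (μ : ℕ → ℕ) (α : ℕ → ℕ → ℝ) : Set SmoothFun :=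
  {f | ∀ h : ℝ → ℝ, Continuous h → h 0 = 0 → ∀ K : Set ℝ, IsCompact K →
    ∃ lam : ℕ → ℕ, StrictMono lam ∧ (∀ n, lam n ∈ Set.range μ) ∧
      TendstoUniformlyOn (fun n x => perturbedSum α f (lam n) x) h atTop K}

/-- The set of `μ`-generalized universal series in `C^∞(ℝ)`: the perturbed Taylor sums with
index in `μ` are dense in `C_0(ℝ)`. -/
def generalizedUniversalSeries (μ : ℕ → ℕ) (α : ℕ → ℕ → ℝ) : Set SmoothFun :=
  {f | Dense (Set.range fun n => perturbedSumC α f (μ n))}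

end GenFekete

end

/-! Everything rests on one perturbation step. Given smooth `g` and an order `N`, the coefficients
of order at most `N` stay frozen. Since the columns of `α` converge, their contribution to the
perturbed sum converges, uniformly on bounded sets, to a fixed polynomial `q`. The rest `h - q`
vanishes at `0`, so it is uniformly close to a polynomial `P` without terms of degree at most `N +
1`. As `α n k ≠ 0`, dividing by it gives the coefficients of order above `N` that make the perturbed
sum reproduce `P`, for every large `n`. A Borel-type rescaling realises them by a function `u` with
small derivatives up to order `N` (`eventually_exists_small_perturbation`).

Iterating this for countably many functions at once gives corrections `e i` and a common sequence
`lam`, later stages never touching coefficients already used (`exists_perturbations_following`). At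
stage `s` one function is asked to follow a member of a dense sequence of `C_0(ℝ)` and the others to
follow `0`. In a combination with bounded coefficients, one nonzero, the errors sum to at most a
multiple of `(s + 1) / 2 ^ s`, so the combination is universal
(`mem_feketeUniversal_of_combination`).

Corrections of a dense sequence span a dense subspace. Corrections of `0`, tagged by bumps away from
the origin from which the coefficients can be read off, give a closed subspace. The `G_δ` property
is the usual countable intersection over a basis of `C_0(ℝ)`. -/

namespace GenFekete

/-! ### Polynomial approximation with high order of vanishing -/

/-- A continuous function vanishing at `0` is, uniformly on a compact interval, a limit of
polynomials without terms of low degree. -/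
theorem exists_polynomial_near_of_coeff_eq_zero {h : ℝ → ℝ} (hc : Continuous h) (h0 : h 0 = 0)
    (N : ℕ) {R ε : ℝ} (hR : 0 < R) (hε : 0 < ε) :
    ∃ P : Polynomial ℝ, (∀ k ≤ N, P.coeff k = 0) ∧ ∀ x, |x| ≤ R → |P.eval x - h x| ≤ ε := by
  obtain ⟨η, hη, hηh⟩ := Metric.continuousAt_iff.1 (hc.continuousAt (x := 0)) (ε / 2) (half_pos hε)
  obtain ⟨C, hC⟩ := (isCompact_Icc (a := -R) (b := R)).exists_bound_of_continuousOn hc.continuousOn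
  have hC0 : 0 ≤ C := (norm_nonneg _).trans (hC 0 ⟨by linarith, hR.le⟩)
  -- Multiplying `h` by `x ^ M / (x ^ M + δ)` makes it divisible by `x ^ M` at little cost: near `0`
  -- because `h` is small, and for `|x| ≥ η` because `δ` is small against `η ^ M`. Evenness of `M`
  -- keeps the denominator positive.
  set M := 2 * (N + 1) with hM
  have hMe : Even M := ⟨N + 1, by omega⟩
  set δ := ε / 2 * η ^ M / (C + 1) with hδ
  have hδ0 : 0 < δ := by positivity
  have hpos : ∀ x : ℝ, 0 < x ^ M + δ := fun x => add_pos_of_nonneg_of_pos (hMe.pow_nonneg x) hδ0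
  obtain ⟨Q, hQ⟩ := exists_polynomial_near_of_continuousOn (-R) R (fun x => h x / (x ^ M + δ))
    (hc.div (by fun_prop) fun x => (hpos x).ne').continuousOn (ε / 2 / R ^ M) (by positivity)
  refine ⟨Q * Polynomial.X ^ M, fun k hk => ?_, fun x hx => ?_⟩
  · rw [Polynomial.coeff_mul_X_pow', if_neg (by omega)]
  have hxI : x ∈ Set.Icc (-R) R := abs_le.1 hx
  have h1 := hQ x hxI
  have hxM : 0 ≤ x ^ M := hMe.pow_nonneg x
  have h2 : |Q.eval x * x ^ M - h x / (x ^ M + δ) * x ^ M| ≤ ε / 2 := by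
    rw [← sub_mul, abs_mul, abs_of_nonneg hxM]
    calc _ ≤ ε / 2 / R ^ M * R ^ M := by
          refine mul_le_mul h1.le ?_ hxM (by positivity)
          rw [← hMe.pow_abs]
          exact pow_le_pow_left₀ (abs_nonneg x) hx M
      _ = ε / 2 := by field_simp
  have h3 : |h x / (x ^ M + δ) * x ^ M - h x| ≤ ε / 2 := by
    have : h x / (x ^ M + δ) * x ^ M - h x = -(h x * (δ / (x ^ M + δ))) := by
      field_simp [(hpos x).ne']
      ring
    rw [this, abs_neg, abs_mul, abs_of_pos (div_pos hδ0 (hpos x))]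
    rcases lt_or_ge |x| η with hlt | hge
    · have := @hηh x (by simpa using hlt)
      rw [h0, Real.dist_eq, sub_zero] at this
      have h4 : δ / (x ^ M + δ) ≤ 1 := (div_le_one (hpos x)).2 (by linarith)
      calc _ ≤ ε / 2 * 1 := mul_le_mul this.le h4 (div_pos hδ0 (hpos x)).le (by positivity)
        _ = _ := mul_one _
    · have h5 : |h x| ≤ C := hC x hxI
      have h6 : η ^ M ≤ x ^ M := by
        rw [← hMe.pow_abs x]
        exact pow_le_pow_left₀ hη.le hge M
      have h7 : δ / (x ^ M + δ) ≤ δ / η ^ M :=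
        div_le_div_of_nonneg_left hδ0.le (by positivity) (by linarith)
      calc _ ≤ C * (δ / η ^ M) := mul_le_mul h5 h7 (div_pos hδ0 (hpos x)).le hC0
        _ = ε / 2 * (C / (C + 1)) := by rw [hδ]; field_simp
        _ ≤ ε / 2 * 1 := by
          gcongr
          exact (div_le_one (by positivity)).2 (by linarith)
        _ = ε / 2 := mul_one _
  rw [Polynomial.eval_mul, Polynomial.eval_pow, Polynomial.eval_X]
  calc _ = |(Q.eval x * x ^ M - h x / (x ^ M + δ) * x ^ M) + (h x / (x ^ M + δ) * x ^ M - h x)| := by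
        congr 1; ring
    _ ≤ _ := abs_add_le _ _
    _ ≤ ε := by linarith

/-! ### Derivatives, Taylor coefficients and perturbed sums as linear functionals -/

@[simp] theorem SmoothFun.add_apply (f g : SmoothFun) (x : ℝ) : (f + g) x = f x + g x := rfl

@[simp] theorem SmoothFun.smul_apply (c : ℝ) (f : SmoothFun) (x : ℝ) : (c • f) x = c * f x := rfl

@[simp] theorem SmoothFun.zero_apply (x : ℝ) : (0 : SmoothFun) x = 0 := rfl

@[ext] theorem SmoothFun.ext {f g : SmoothFun} (h : ∀ x, f x = g x) : f = g :=
  Subtype.ext (funext h)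

/-- The `k`-th derivative at a point, as a linear functional. -/
noncomputable def derivAt (k : ℕ) (x : ℝ) : SmoothFun →ₗ[ℝ] ℝ where
  toFun f := iteratedDeriv k f x
  map_add' f g := SmoothFun.iteratedDeriv_add f g k x
  map_smul' c f := SmoothFun.iteratedDeriv_smul c f k x

@[simp] theorem derivAt_zero_left (x : ℝ) (f : SmoothFun) : derivAt 0 x f = f x := by
  simp [derivAt]

theorem derivAt_congr {f g : SmoothFun} {x : ℝ} (h : ∀ᶠ y in 𝓝 x, f y = g y) (k : ℕ) :
    derivAt k x f = derivAt k x g :=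
  Filter.EventuallyEq.iteratedDeriv_eq k h

theorem taylorCoeff_eq (f : SmoothFun) (k : ℕ) :
    taylorCoeff f k = derivAt k 0 f / (k.factorial : ℝ) := rfl

theorem taylorCoeff_add (f g : SmoothFun) (k : ℕ) :
    taylorCoeff (f + g) k = taylorCoeff f k + taylorCoeff g k := by
  simp [taylorCoeff_eq, add_div]

theorem taylorCoeff_smul (c : ℝ) (f : SmoothFun) (k : ℕ) :
    taylorCoeff (c • f) k = c * taylorCoeff f k := by
  simp [taylorCoeff_eq, mul_div_assoc]

theorem taylorCoeff_sum {ι : Type*} (s : Finset ι) (f : ι → SmoothFun) (k : ℕ) :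
    taylorCoeff (∑ i ∈ s, f i) k = ∑ i ∈ s, taylorCoeff (f i) k := by
  simp [taylorCoeff_eq, Finset.sum_div]

theorem perturbedSum_congr (α : ℕ → ℕ → ℝ) {f g : SmoothFun} {n : ℕ}
    (h : ∀ k ≤ n, taylorCoeff f k = taylorCoeff g k) (x : ℝ) :
    perturbedSum α f n x = perturbedSum α g n x :=
  Finset.sum_congr rfl fun k hk => by rw [h k (by simpa [Nat.lt_succ_iff] using hk)]

/-- The perturbed Taylor sum at a point, as a linear functional. -/
noncomputable def perturbedSumAt (α : ℕ → ℕ → ℝ) (n : ℕ) (x : ℝ) : SmoothFun →ₗ[ℝ] ℝ where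
  toFun f := perturbedSum α f n x
  map_add' f g := by
    simp only [perturbedSum, taylorCoeff_add, add_mul, Finset.sum_add_distrib]
  map_smul' c f := by
    simp only [perturbedSum, taylorCoeff_smul, Finset.mul_sum, RingHom.id_apply, smul_eq_mul,
      mul_assoc]

theorem perturbedSumAt_apply (α : ℕ → ℕ → ℝ) (n : ℕ) (x : ℝ) (f : SmoothFun) :
    perturbedSumAt α n x f = perturbedSum α f n x := rfl

theorem derivAt_eq_zero_of_abs_gt {f : SmoothFun} (hf : ∀ x, 1 ≤ |x| → f x = 0) (k : ℕ) {x : ℝ}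
    (hx : 1 < |x|) : derivAt k x f = 0 := by
  rw [derivAt_congr (g := 0), map_zero]
  filter_upwards [(isOpen_lt continuous_const continuous_abs).mem_nhds hx] with y hy
  exact hf y (le_of_lt hy)

theorem exists_abs_derivAt_le {f : SmoothFun} (hf : ∀ x, 1 ≤ |x| → f x = 0) (k : ℕ) :
    ∃ C, ∀ x, |derivAt k x f| ≤ C := by
  obtain ⟨C, hC⟩ := (isCompact_Icc (a := -(1 : ℝ)) (b := 1)).exists_bound_of_continuousOn
    (f.continuous_iteratedDeriv k).continuousOn
  refine ⟨C, fun x => ?_⟩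
  rcases le_or_gt |x| 1 with h | h
  · exact hC x (abs_le.1 h)
  · rw [derivAt_eq_zero_of_abs_gt hf k h, abs_zero]
    exact (norm_nonneg _).trans (hC 0 (by simp))

/-! ### Small smooth functions with prescribed Taylor coefficients -/

/-- A monomial germ at `0` of high degree is the germ of a small smooth function. -/
theorem exists_small_monomial {N m : ℕ} (hm : N < m) {ε : ℝ} (hε : 0 < ε) :
    ∃ u : SmoothFun, (∀ k, taylorCoeff u k = if k = m then 1 else 0) ∧
      (∀ x, 1 ≤ |x| → u x = 0) ∧ ∀ k ≤ N, ∀ x, |derivAt k x u| ≤ ε := by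
  let b : ContDiffBump (0 : ℝ) := ⟨1 / 2, 1, by norm_num, by norm_num⟩
  have hbs : ContDiff ℝ ∞ (b : ℝ → ℝ) := b.contDiff
  let ψ : SmoothFun := ⟨fun x => x ^ m * b x, (contDiff_id.pow m).mul hbs⟩
  have hψ : ∀ x, 1 ≤ |x| → ψ x = 0 := fun x hx => by
    change x ^ m * b x = 0
    rw [b.zero_of_le_dist (by simpa using hx), mul_zero]
  choose C hC using exists_abs_derivAt_le hψ
  set B := ∑ k ∈ Finset.range (N + 1), C k with hB
  have hC0 : ∀ k, 0 ≤ C k := fun k => (abs_nonneg _).trans (hC k 0)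
  have hB0 : 0 ≤ B := Finset.sum_nonneg fun k _ => hC0 k
  set δ := min 1 (ε / (B + 1)) with hδ
  have hδ0 : 0 < δ := lt_min one_pos (by positivity)
  have hδ1 : δ ≤ 1 := min_le_left _ _
  -- This scaling preserves the germ `x ^ m` at `0` and multiplies the size of the `k`-th derivative
  -- by `δ ^ (m - k)`, which is at most `δ` when `k ≤ N < m`.
  let u : SmoothFun := ⟨fun x => δ ^ m * ψ (δ⁻¹ * x),
    contDiff_const.mul (ψ.contDiff.comp (contDiff_const.mul contDiff_id))⟩
  have hu : ∀ k x, derivAt k x u = δ ^ m * ((δ⁻¹) ^ k * derivAt k (δ⁻¹ * x) ψ) := fun k x => by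
    change iteratedDeriv k (fun x => δ ^ m * ψ (δ⁻¹ * x)) x = _
    rw [iteratedDeriv_const_mul_field (f := fun x => ψ (δ⁻¹ * x)), iteratedDeriv_comp_const_mul
      (ψ.contDiff.of_le (by exact_mod_cast le_top))]
    rfl
  refine ⟨u, fun k => ?_, fun x hx => ?_, fun k hk x => ?_⟩
  · have h1 : derivAt k 0 ψ = iteratedDeriv k (fun x : ℝ => x ^ m) 0 := by
      refine Filter.EventuallyEq.iteratedDeriv_eq k ?_
      filter_upwards [Metric.ball_mem_nhds (0 : ℝ) (by norm_num : (0 : ℝ) < 1 / 2)] with y hy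
      change y ^ m * b y = y ^ m
      rw [b.one_of_mem_closedBall (Metric.ball_subset_closedBall hy), mul_one]
    rw [taylorCoeff_eq, hu, mul_zero, h1, iteratedDeriv_pow]
    split_ifs with hkm
    · subst hkm
      have : ((k.factorial : ℕ) : ℝ) ≠ 0 := by exact_mod_cast k.factorial_ne_zero
      simp [Nat.descFactorial_self]
      field_simp
    · rcases lt_or_gt_of_ne hkm with h | h
      · rw [zero_pow (by omega)]; simp
      · rw [Nat.descFactorial_eq_zero_iff_lt.2 h]; simp
  · change δ ^ m * ψ (δ⁻¹ * x) = 0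
    rw [hψ, mul_zero]
    rw [abs_mul, abs_of_pos (inv_pos.2 hδ0)]
    exact one_le_mul_of_one_le_of_one_le ((one_le_inv₀ hδ0).2 hδ1) hx
  · have h1 : δ ^ m * (δ⁻¹) ^ k = δ ^ (m - k) := by
      rw [inv_pow, ← div_eq_mul_inv, pow_sub₀ _ hδ0.ne' (by omega), div_eq_mul_inv]
    rw [hu, ← mul_assoc, h1, abs_mul, abs_of_pos (pow_pos hδ0 _)]
    calc δ ^ (m - k) * |derivAt k (δ⁻¹ * x) ψ| ≤ δ * (B + 1) := by
          refine mul_le_mul (pow_le_of_le_one hδ0.le hδ1 (by omega)) ?_ (abs_nonneg _) hδ0.le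
          have := Finset.single_le_sum (f := C) (fun k _ => hC0 k)
            (Finset.mem_range.2 (Nat.lt_succ_of_le hk))
          linarith [hC k (δ⁻¹ * x)]
      _ ≤ ε / (B + 1) * (B + 1) := by gcongr; exact min_le_right _ _
      _ = ε := by field_simp

/-- Finitely many Taylor coefficients of high order can be prescribed for a small smooth
function. -/
theorem exists_small_taylorCoeff (N n : ℕ) (a : ℕ → ℝ) (ha : ∀ k ≤ N, a k = 0) {ε : ℝ}
    (hε : 0 < ε) :
    ∃ u : SmoothFun, (∀ k ≤ n, taylorCoeff u k = a k) ∧ (∀ k ≤ N, taylorCoeff u k = 0) ∧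
      (∀ x, 1 ≤ |x| → u x = 0) ∧ ∀ k ≤ N, ∀ x, |derivAt k x u| ≤ ε := by
  have hex : ∀ m, ∃ v : SmoothFun, (∀ k, taylorCoeff v k = if k = m then a m else 0) ∧
      (∀ x, 1 ≤ |x| → v x = 0) ∧ ∀ k ≤ N, ∀ x, |derivAt k x v| ≤ ε / (n + 1) := by
    intro m
    rcases le_or_gt m N with hmN | hmN
    · refine ⟨0, fun k => ?_, fun _ _ => rfl, fun k _ x => ?_⟩
      · simp [taylorCoeff_eq, ha m hmN]
      · rw [map_zero, abs_zero]; positivity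
    obtain ⟨u, hu1, hu2, hu3⟩ := exists_small_monomial hmN
      (show 0 < ε / (n + 1) / (|a m| + 1) by positivity)
    refine ⟨a m • u, fun k => ?_, fun x hx => ?_, fun k hk x => ?_⟩
    · rw [taylorCoeff_smul, hu1]; simp
    · rw [SmoothFun.smul_apply, hu2 x hx, mul_zero]
    · rw [map_smul, smul_eq_mul, abs_mul]
      calc _ ≤ (|a m| + 1) * (ε / (n + 1) / (|a m| + 1)) :=
            mul_le_mul (by linarith) (hu3 k hk x) (abs_nonneg _) (by positivity)
        _ = _ := by field_simp
  choose v hv1 hv2 hv3 using hex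
  have hcoeff : ∀ k, taylorCoeff (∑ m ∈ Finset.range (n + 1), v m) k =
      if k ∈ Finset.range (n + 1) then a k else 0 := fun k => by
    rw [taylorCoeff_sum]
    simp only [hv1, Finset.sum_ite_eq]
  refine ⟨∑ m ∈ Finset.range (n + 1), v m, fun k hk => ?_, fun k hk => ?_, fun x hx => ?_,
    fun k hk x => ?_⟩
  · rw [hcoeff, if_pos (Finset.mem_range.2 (Nat.lt_succ_of_le hk))]
  · rw [hcoeff, ha k hk, ite_self]
  · rw [← derivAt_zero_left, map_sum]
    exact Finset.sum_eq_zero fun m _ => by rw [derivAt_zero_left, hv2 m x hx]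
  · rw [map_sum]
    calc _ ≤ ∑ m ∈ Finset.range (n + 1), |derivAt k x (v m)| := Finset.abs_sum_le_sum_abs _ _
      _ ≤ ∑ _m ∈ Finset.range (n + 1), ε / (n + 1) := Finset.sum_le_sum fun m _ => hv3 m k hk x
      _ = ε := by simp; field_simp

/-- Termwise differentiation of a series of smooth functions. -/
theorem exists_hasSum_derivAt (w : ℕ → SmoothFun) (hb : ∀ i k, ∃ C, ∀ x, |derivAt k x (w i)| ≤ C)
    (hs : ∀ k, ∃ v : ℕ → ℝ, Summable v ∧ ∀ᶠ i in atTop, ∀ x, |derivAt k x (w i)| ≤ v i) :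
    ∃ f : SmoothFun, ∀ k x, HasSum (fun i => derivAt k x (w i)) (derivAt k x f) := by
  choose C hC using hb
  choose v hv hv' using hs
  -- The summable bound may start late; the finitely many earlier terms use their own bounds `C i
  -- k`.
  have hV : ∀ k, ∃ V : ℕ → ℝ, Summable V ∧ ∀ i x, |derivAt k x (w i)| ≤ V i := fun k => by
    obtain ⟨n, hn⟩ := eventually_atTop.1 (hv' k)
    refine ⟨fun i => if i < n then C i k else v k i, ?_, fun i x => ?_⟩
    · refine (summable_congr_cofinite ?_).2 (hv k)
      rw [Nat.cofinite_eq_atTop]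
      filter_upwards [eventually_ge_atTop n] with i hi
      rw [if_neg (not_lt.2 hi)]
    · dsimp only
      split_ifs with h
      · exact hC i k x
      · exact hn i (not_lt.1 h) x
  choose V hV hV' using hV
  have hn : ∀ (k : ℕ) (i : ℕ) (x : ℝ), ((k : ℕ∞) ≤ (⊤ : ℕ∞)) →
      ‖iteratedFDeriv ℝ k (w i : ℝ → ℝ) x‖ ≤ V k i := fun k i x _ => by
    rw [norm_iteratedFDeriv_eq_norm_iteratedDeriv]
    exact hV' k i x
  refine ⟨⟨fun x => ∑' i, w i x, contDiff_tsum (N := ⊤) (fun i => (w i).contDiff)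
    (fun k _ => hV k) hn⟩, fun k x => ?_⟩
  have hsum : Summable fun i => iteratedFDeriv ℝ k (w i : ℝ → ℝ) x :=
    Summable.of_norm_bounded (hV k) fun i => hn k i x le_top
  have h1 := congrFun (iteratedFDeriv_tsum (N := ⊤) (fun i => (w i).contDiff)
    (fun k _ => hV k) hn (k := k) le_top) x
  have h2 := (ContinuousMultilinearMap.apply ℝ (fun _ : Fin k => ℝ) ℝ
    (fun _ => (1 : ℝ))).hasSum hsum.hasSum
  rw [← h1] at h2
  exact h2

/-! ### The perturbation step and its iteration -/

/-- For all large `n`, a small smooth perturbation of `g` of high order at `0` has its `n`-th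
perturbed Taylor sum close to a prescribed function. -/
theorem eventually_exists_small_perturbation {α : ℕ → ℕ → ℝ}
    (hα0 : ∀ n k : ℕ, k ≤ n → α n k ≠ 0)
    (hα : ∀ k : ℕ, ∃ l : ℝ, Tendsto (fun n => α n k) atTop (𝓝 l))
    (g : SmoothFun) (N : ℕ) {h : ℝ → ℝ} (hc : Continuous h) (h0 : h 0 = 0) (R : ℝ) {ε : ℝ}
    (hε : 0 < ε) :
    ∀ᶠ n in atTop, ∃ u : SmoothFun, (∀ k ≤ N, taylorCoeff u k = 0) ∧
      (∀ x, 1 ≤ |x| → u x = 0) ∧ (∀ k ≤ N, ∀ x, |derivAt k x u| ≤ ε) ∧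
      ∀ x : ℝ, |x| ≤ R → |perturbedSum α (g + u) n x - h x| ≤ ε := by
  choose l hl using hα
  set S := |R| + 1 with hS
  have hS0 : 0 < S := by positivity
  -- The limit of the contribution of the frozen coefficients. As order `k` feeds degree `k + 1`,
  -- the polynomial approximating `h - q` must vanish up to degree `N + 1`.
  let q : ℝ → ℝ := fun x => ∑ k ∈ Finset.range (N + 1), taylorCoeff g k * l k * x ^ (k + 1)
  obtain ⟨P, hP0, hP⟩ := exists_polynomial_near_of_coeff_eq_zero (h := fun x => h x - q x)
    (hc.sub (by fun_prop)) (by simp [h0, q]) (N + 1) hS0 (half_pos hε)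
  have hlim : Tendsto (fun n => ∑ k ∈ Finset.range (N + 1),
      |taylorCoeff g k| * |α n k - l k| * S ^ (k + 1)) atTop (𝓝 0) := by
    have : Tendsto (fun n => ∑ k ∈ Finset.range (N + 1),
        |taylorCoeff g k| * |α n k - l k| * S ^ (k + 1)) atTop
        (𝓝 (∑ k ∈ Finset.range (N + 1), |taylorCoeff g k| * |l k - l k| * S ^ (k + 1))) :=
      tendsto_finsetSum _ fun k _ =>
        ((((hl k).sub tendsto_const_nhds).abs).const_mul _).mul_const _
    simpa using this
  filter_upwards [hlim.eventually_le_const (half_pos hε), eventually_ge_atTop N,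
    eventually_ge_atTop P.natDegree] with n hn hnN hnP
  obtain ⟨u, hu1, hu2, hu3, hu4⟩ := exists_small_taylorCoeff N n
    (fun k => if k ≤ N then 0 else P.coeff (k + 1) / α n k - taylorCoeff g k)
    (fun k hk => if_pos hk) hε
  refine ⟨u, hu2, hu3, hu4, fun x hx => ?_⟩
  have hxS : |x| ≤ S := by linarith [le_abs_self R]
  have hPx : P.eval x = ∑ k ∈ Finset.range (n + 1), P.coeff (k + 1) * x ^ (k + 1) := by
    rw [Polynomial.eval_eq_sum_range' (n := n + 2) (by omega), Finset.sum_range_succ',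
      hP0 0 (by omega)]
    simp
  have hdecomp : perturbedSum α (g + u) n x - h x = (P.eval x - (h x - q x)) +
      ∑ k ∈ Finset.range (N + 1), taylorCoeff g k * (α n k - l k) * x ^ (k + 1) := by
    have hsub : Finset.range (N + 1) ⊆ Finset.range (n + 1) :=
      Finset.range_subset_range.2 (by omega)
    have h1 : perturbedSum α (g + u) n x = P.eval x +
        ∑ k ∈ Finset.range (N + 1), taylorCoeff g k * α n k * x ^ (k + 1) := by
      rw [hPx, perturbedSum, ← Finset.sum_sdiff hsub,
        ← Finset.sum_sdiff (f := fun k => P.coeff (k + 1) * x ^ (k + 1)) hsub, add_assoc,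
        ← Finset.sum_add_distrib]
      congr 1
      · refine Finset.sum_congr rfl fun k hk => ?_
        simp only [Finset.mem_sdiff, Finset.mem_range] at hk
        rw [taylorCoeff_add, hu1 k (by omega), if_neg (by omega)]
        field_simp [hα0 n k (by omega)]
        ring
      · refine Finset.sum_congr rfl fun k hk => ?_
        simp only [Finset.mem_range] at hk
        rw [taylorCoeff_add, hu2 k (by omega), hP0 (k + 1) (by omega)]
        ring
    rw [h1]
    simp only [q, mul_sub, sub_mul, Finset.sum_sub_distrib]
    ring
  rw [hdecomp]
  refine (abs_add_le _ _).trans ?_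
  have h2 : |∑ k ∈ Finset.range (N + 1), taylorCoeff g k * (α n k - l k) * x ^ (k + 1)| ≤
      ∑ k ∈ Finset.range (N + 1), |taylorCoeff g k| * |α n k - l k| * S ^ (k + 1) := by
    refine (Finset.abs_sum_le_sum_abs _ _).trans (Finset.sum_le_sum fun k _ => ?_)
    rw [abs_mul, abs_mul, abs_pow]
    gcongr
  linarith [hP x hxS]

/-- Simultaneous construction: small perturbations `e i` of given smooth functions `g i` such that,
along a subsequence, the perturbed Taylor sums of `g i + e i` follow prescribed targets. -/
theorem exists_perturbations_following {μ : ℕ → ℕ} (hμ : StrictMono μ) {α : ℕ → ℕ → ℝ}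
    (hα0 : ∀ n k : ℕ, k ≤ n → α n k ≠ 0)
    (hα : ∀ k : ℕ, ∃ l : ℝ, Tendsto (fun n => α n k) atTop (𝓝 l))
    (g : ℕ → SmoothFun) (T : ℕ → ℕ → ℝ → ℝ) (hTc : ∀ s i, Continuous (T s i))
    (hT0 : ∀ s i, T s i 0 = 0) :
    ∃ (lam : ℕ → ℕ) (e : ℕ → SmoothFun), StrictMono lam ∧ (∀ s, lam s ∈ Set.range μ) ∧
      (∀ i x, 1 ≤ |x| → e i x = 0) ∧
      (∀ i, ∀ k ≤ i, ∀ x, |derivAt k x (e i)| ≤ 2 * (1 / 2) ^ i) ∧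
      (∀ i s, s < i → ∀ k ≤ lam s, taylorCoeff (e i) k = 0) ∧
      ∀ i s : ℕ, i ≤ s → ∀ x : ℝ, |x| ≤ s →
        |perturbedSum α (g i + e i) (lam s) x - T s i x| ≤ (1 / 2) ^ s := by
  have hstep : ∀ (s n : ℕ) (G : ℕ → SmoothFun), ∃ (m : ℕ) (w : ℕ → SmoothFun),
      n < m ∧ m ∈ Set.range μ ∧ (∀ i, ∀ k ≤ n, taylorCoeff (w i) k = 0) ∧
      (∀ i x, 1 ≤ |x| → w i x = 0) ∧
      (∀ i, ∀ k ≤ s, ∀ x, |derivAt k x (w i)| ≤ (1 / 2) ^ s) ∧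
      (∀ i ≤ s, ∀ x : ℝ, |x| ≤ s → |perturbedSum α (G i + w i) m x - T s i x| ≤ (1 / 2) ^ s) ∧
      ∀ i, s < i → w i = 0 := by
    intro s n G
    -- The order `max n s` serves two purposes: `n` protects the perturbed sums already arranged,
    -- `s` gives the derivative bounds that make the corrections summable.
    have hev : ∀ᶠ m in atTop, ∀ i ∈ Finset.range (s + 1), ∃ u : SmoothFun,
        (∀ k ≤ max n s, taylorCoeff u k = 0) ∧ (∀ x, 1 ≤ |x| → u x = 0) ∧
        (∀ k ≤ max n s, ∀ x, |derivAt k x u| ≤ (1 / 2) ^ s) ∧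
        ∀ x : ℝ, |x| ≤ s → |perturbedSum α (G i + u) m x - T s i x| ≤ (1 / 2) ^ s :=
      (Filter.eventually_all_finset _).2 fun i _ =>
        eventually_exists_small_perturbation hα0 hα (G i) (max n s) (hTc s i) (hT0 s i) s
          (by positivity)
    obtain ⟨j, hj, hnj⟩ :=
      ((hμ.tendsto_atTop.eventually hev).and
        (hμ.tendsto_atTop.eventually (eventually_gt_atTop n))).exists
    choose! w hw1 hw2 hw3 hw4 using hj
    refine ⟨μ j, fun i => if i ≤ s then w i else 0, hnj, ⟨j, rfl⟩, fun i k hk => ?_,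
      fun i x hx => ?_, fun i k hk x => ?_, fun i hi x hx => ?_, fun i hi => if_neg (by omega)⟩
    · dsimp only
      split_ifs with hi
      · exact hw1 i (by simpa [Nat.lt_succ_iff] using hi) k (by omega)
      · simp [taylorCoeff_eq]
    · dsimp only
      split_ifs with hi
      · exact hw2 i (by simpa [Nat.lt_succ_iff] using hi) x hx
      · rfl
    · dsimp only
      split_ifs with hi
      · exact hw3 i (by simpa [Nat.lt_succ_iff] using hi) k (by omega) x
      · rw [map_zero, abs_zero]; positivity
    · dsimp only
      rw [if_pos hi]
      exact hw4 i (by simpa [Nat.lt_succ_iff] using hi) x hx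
  choose m w hnm hmμ hw1 hw2 hw3 hw4 hw5 using hstep
  let st : ℕ → ℕ × (ℕ → SmoothFun) := fun s => Nat.rec (0, g)
    (fun s p => (m s p.1 p.2, fun i => p.2 i + w s p.1 p.2 i)) s
  -- The shift by one skips the dummy initial index `0`, which need not belong to the range of `μ`.
  let lam : ℕ → ℕ := fun s => (st (s + 1)).1
  let W : ℕ → ℕ → SmoothFun := fun i s => w s (st s).1 (st s).2 i
  have hlt : ∀ s, (st s).1 < (st (s + 1)).1 := fun s => hnm s (st s).1 (st s).2
  have hmono : StrictMono fun s => (st s).1 := strictMono_nat_of_lt_succ hlt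
  have hG : ∀ i s, (st s).2 i = g i + ∑ t ∈ Finset.range s, W i t := by
    intro i s
    induction s with
    | zero => simp [st]
    | succ s ih =>
      rw [Finset.sum_range_succ, ← add_assoc, ← ih]
  have hex : ∀ i, ∃ f : SmoothFun, ∀ k x,
      HasSum (fun s => derivAt k x (W i s)) (derivAt k x f) := fun i =>
    exists_hasSum_derivAt (W i) (fun s k => exists_abs_derivAt_le (hw2 s _ _ i) k) fun k =>
      ⟨fun s => (1 / 2) ^ s, summable_geometric_two, (eventually_ge_atTop k).mono
        fun s hs x => hw3 s _ _ i k hs x⟩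
  choose e he using hex
  have hWtaylor : ∀ i s t, s < t → ∀ k ≤ lam s, taylorCoeff (W i t) k = 0 :=
    fun i s t hst k hk => hw1 t _ _ i k (hk.trans (hmono.monotone hst))
  have hetaylor : ∀ i s, ∀ k ≤ lam s,
      taylorCoeff (e i) k = taylorCoeff (∑ t ∈ Finset.range (s + 1), W i t) k := by
    intro i s k hk
    have h1 : HasSum (fun t => taylorCoeff (W i t) k) (taylorCoeff (e i) k) :=
      (he i k 0).div_const _
    rw [taylorCoeff_sum]
    refine h1.unique (hasSum_sum_of_ne_finset_zero fun t ht =>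
      hWtaylor i s t (by simpa using ht) k hk)
  refine ⟨lam, e, hmono.comp (strictMono_id.add_const 1), fun s => hmμ s _ _, fun i x hx => ?_,
    fun i k hk x => ?_, fun i s hsi k hk => ?_, fun i s his x hx => ?_⟩
  · have h1 := he i 0 x
    simp only [derivAt_zero_left] at h1
    exact h1.unique (by simpa only [W, hw2 _ _ _ i x hx] using hasSum_zero)
  · have h1 : ∀ s, s ∉ Set.Ici i → derivAt k x (W i s) = 0 := fun s hs => by
      simp only [W, hw5 s _ _ i (by simpa using hs), map_zero]
    have h2 : ∀ s, |derivAt k x (W i (s + i))| ≤ (1 / 2) ^ i * (1 / 2) ^ s := fun s => by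
      rw [← pow_add, add_comm i s]
      exact hw3 (s + i) _ _ i k (by omega) x
    have h3 : HasSum (fun s => derivAt k x (W i (s + i))) (derivAt k x (e i)) := by
      rw [hasSum_nat_add_iff (f := fun s => derivAt k x (W i s)) i,
        Finset.sum_eq_zero (fun s hs => h1 s (by simpa using hs)), add_zero]
      exact he i k x
    rw [← h3.tsum_eq]
    have h4 := tsum_of_norm_bounded (f := fun s => derivAt k x (W i (s + i)))
      (hasSum_geometric_two.mul_left ((1 / 2 : ℝ) ^ i)) h2
    rwa [mul_comm] at h4
  · rw [hetaylor i s k hk, taylorCoeff_sum]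
    refine Finset.sum_eq_zero fun t ht => ?_
    simp only [W]
    rw [hw5 t _ _ i (by have := Finset.mem_range.1 ht; omega)]
    simp [taylorCoeff_eq]
  · rw [perturbedSum_congr α (g := (st s).2 i + W i s) (fun k hk => ?_)]
    · exact hw4 s _ _ i his x hx
    · rw [hG, taylorCoeff_add, hetaylor i s k hk, add_assoc, ← Finset.sum_range_succ,
        ← taylorCoeff_add]

/-! ### The topology of the space of smooth functions -/

instance : IsTopologicalAddGroup SmoothFun :=
  withSeminorms_smoothSeminormFamily.topologicalAddGroup

instance : ContinuousSMul ℝ SmoothFun :=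
  withSeminorms_smoothSeminormFamily.continuousSMul

theorem abs_derivAt_le_smoothSeminorm {n k : ℕ} (hk : k ≤ n) {x : ℝ} (hx : |x| ≤ n)
    (f : SmoothFun) : |derivAt k x f| ≤ smoothSeminorm n f := by
  have h0 : ∀ j, 0 ≤ supDeriv n j f := fun j => Real.iSup_nonneg fun _ => abs_nonneg _
  exact (le_ciSup (bddAbove_supDeriv n k f) ⟨x, abs_le.1 hx⟩).trans
    (Finset.single_le_sum (f := fun j => supDeriv n j f) (fun j _ => h0 j)
      (Finset.mem_range.2 (Nat.lt_succ_of_le hk)))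

theorem smoothSeminorm_le {n : ℕ} {f : SmoothFun} {B : ℝ}
    (h : ∀ k ≤ n, ∀ x : ℝ, |x| ≤ n → |derivAt k x f| ≤ B) :
    smoothSeminorm n f ≤ (n + 1) * B := by
  have : Nonempty (Set.Icc (-(n : ℝ)) n) := ⟨⟨0, by simp⟩⟩
  calc smoothSeminorm n f = ∑ k ∈ Finset.range (n + 1), supDeriv n k f := rfl
    _ ≤ ∑ _k ∈ Finset.range (n + 1), B := Finset.sum_le_sum fun k hk => ciSup_le fun x =>
        h k (Nat.lt_succ_iff.1 (Finset.mem_range.1 hk)) x (abs_le.2 x.2)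
    _ = (n + 1) * B := by simp

/-- A linear functional that is bounded by one of the defining seminorms is continuous. -/
theorem continuous_of_le_smoothSeminorm (φ : SmoothFun →ₗ[ℝ] ℝ) (n : ℕ) {C : ℝ} (hC : 0 ≤ C)
    (h : ∀ f, |φ f| ≤ C * smoothSeminorm n f) : Continuous φ := by
  refine withSeminorms_smoothSeminormFamily.continuous_normedSpace_rng ℝ φ
    ⟨{n}, ⟨C, hC⟩, fun f => ?_⟩
  rw [Finset.sup_singleton]
  exact h f

theorem continuous_derivAt (k : ℕ) (x : ℝ) : Continuous (derivAt k x) := by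
  obtain ⟨n, hn⟩ := exists_nat_ge |x|
  refine continuous_of_le_smoothSeminorm _ (max n k) zero_le_one fun f => ?_
  rw [one_mul]
  exact abs_derivAt_le_smoothSeminorm (le_max_right _ _)
    (hn.trans (by exact_mod_cast le_max_left n k)) f

theorem continuous_taylorCoeff (k : ℕ) : Continuous fun f : SmoothFun => taylorCoeff f k :=
  (continuous_derivAt k 0).div_const _

theorem continuous_perturbedSumC (α : ℕ → ℕ → ℝ) (n : ℕ) :
    Continuous fun f => perturbedSumC α f n := by
  refine Continuous.subtype_mk (ContinuousMap.continuous_of_continuous_uncurry _ ?_) _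
  change Continuous fun p : SmoothFun × ℝ =>
    ∑ k ∈ Finset.range (n + 1), taylorCoeff p.1 k * α n k * p.2 ^ (k + 1)
  have := continuous_taylorCoeff
  fun_prop

/-- The map sending a smooth function to all its derivatives. -/
noncomputable def allDerivs : SmoothFun →+ (ℕ → C(ℝ, ℝ)) where
  toFun f k := ⟨iteratedDeriv k f, f.continuous_iteratedDeriv k⟩
  map_zero' := by
    ext k x
    exact map_zero (derivAt k x)
  map_add' f g := by
    ext k x
    exact map_add (derivAt k x) f g

theorem allDerivs_apply (f : SmoothFun) (k : ℕ) (x : ℝ) : allDerivs f k x = derivAt k x f := rfl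

/-- The seminorms measure uniform convergence of every derivative on compact sets. Embedding into a
countable product of second countable spaces provides the countable dense sets needed below. -/
theorem isInducing_allDerivs : IsInducing allDerivs := by
  rw [IsTopologicalAddGroup.isInducing_iff_nhds_zero]
  refine le_antisymm ?_ ?_
  · rw [← tendsto_iff_comap, tendsto_pi_nhds]
    intro k
    rw [ContinuousMap.tendsto_iff_forall_isCompact_tendstoUniformlyOn]
    intro K hK
    rw [Metric.tendstoUniformlyOn_iff]
    intro ε hε
    obtain ⟨R, hR⟩ := hK.isBounded.exists_norm_le
    obtain ⟨n, hn⟩ := exists_nat_ge R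
    have h1 : Tendsto (smoothSeminorm (max n k)) (𝓝 0) (𝓝 0) := by
      have := (withSeminorms_smoothSeminormFamily.continuous_seminorm (max n k)).tendsto 0
      rwa [map_zero] at this
    filter_upwards [h1.eventually_lt_const hε] with f hf x hx
    rw [dist_comm, Pi.zero_apply, ContinuousMap.zero_apply, dist_zero_right, allDerivs_apply]
    exact (abs_derivAt_le_smoothSeminorm (le_max_right _ _)
      (((hR x hx).trans hn).trans (by exact_mod_cast le_max_left n k)) f).trans_lt hf
  · refine (withSeminorms_smoothSeminormFamily.tendsto_nhds (f := comap allDerivs (𝓝 0)) id 0).2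
      fun n ε hε => ?_
    -- Dividing by `n + 2` makes the sum of `n + 1` such bounds strictly less than `ε`.
    have h1 : ∀ k ∈ Finset.range (n + 1), ∀ᶠ F : ℕ → C(ℝ, ℝ) in 𝓝 0,
        Set.MapsTo (F k) (Set.Icc (-(n : ℝ)) n) (Metric.ball 0 (ε / (n + 2))) := by
      intro k _
      have hopen : IsOpen {φ : C(ℝ, ℝ) |
          Set.MapsTo φ (Set.Icc (-(n : ℝ)) n) (Metric.ball 0 (ε / (n + 2)))} :=
        ContinuousMap.isOpen_setOfPred_mapsTo isCompact_Icc Metric.isOpen_ball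
      have happ : Continuous fun F : ℕ → C(ℝ, ℝ) => F k := continuous_apply k
      refine (hopen.preimage happ).mem_nhds ?_
      intro x _
      have : 0 < ε / (n + 2) := by positivity
      simpa using this
    filter_upwards [preimage_mem_comap ((Filter.eventually_all_finset _).2 h1)] with f hf
    rw [id, sub_zero]
    refine (smoothSeminorm_le (B := ε / (n + 2)) fun k hk x hx => ?_).trans_lt ?_
    · have := hf k (Finset.mem_range.2 (Nat.lt_succ_of_le hk)) (abs_le.1 hx)
      rw [mem_ball_zero_iff] at this
      exact this.le
    · rw [mul_div_assoc', div_lt_iff₀ (by positivity)]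
      nlinarith

instance : SecondCountableTopology SmoothFun := isInducing_allDerivs.secondCountableTopology

instance : SecondCountableTopology vanishingAtZero :=
  IsInducing.subtypeVal.secondCountableTopology

/-! ### Equivalent forms of universality and the `G_δ` property -/

theorem isOpen_setOf_abs_sub_lt (h : ℝ → ℝ) (hc : Continuous h) (R ε : ℝ) :
    IsOpen {g : vanishingAtZero | ∀ x : ℝ, |x| ≤ R → |g.1 x - h x| < ε} := by
  have h1 : Continuous fun g : vanishingAtZero => g.1 - (⟨h, hc⟩ : C(ℝ, ℝ)) :=
    continuous_subtype_val.sub continuous_const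
  convert (ContinuousMap.isOpen_setOfPred_mapsTo (isCompact_Icc (a := -R) (b := R))
    (Metric.isOpen_ball (x := (0 : ℝ)) (ε := ε))).preimage h1 using 1
  ext g
  simp [Set.MapsTo, abs_le]

theorem exists_mem_abs_sub_lt_of_dense {D : Set vanishingAtZero} (hD : Dense D) {h : ℝ → ℝ}
    (hc : Continuous h) (h0 : h 0 = 0) (R : ℝ) {ε : ℝ} (hε : 0 < ε) :
    ∃ g ∈ D, ∀ x : ℝ, |x| ≤ R → |g.1 x - h x| < ε := by
  obtain ⟨g, hg, hgD⟩ := hD.inter_open_nonempty _ (isOpen_setOf_abs_sub_lt h hc R ε)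
    ⟨⟨⟨h, hc⟩, h0⟩, fun x _ => by simpa using hε⟩
  exact ⟨g, hgD, hg⟩

theorem mem_feketeUniversal_of_forall_exists {μ : ℕ → ℕ} (hμ : StrictMono μ) {α : ℕ → ℕ → ℝ}
    {f : SmoothFun}
    (H : ∀ h : ℝ → ℝ, Continuous h → h 0 = 0 → ∀ R ε : ℝ, 0 < ε → ∀ M : ℕ,
      ∃ m ≥ M, m ∈ Set.range μ ∧ ∀ x : ℝ, |x| ≤ R → |perturbedSum α f m x - h x| ≤ ε) :
    f ∈ feketeUniversal μ α := by
  intro h hc h0 K hK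
  obtain ⟨R, hR⟩ := hK.isBounded.exists_norm_le
  have h1 : ∀ n : ℕ, ∃ᶠ k in atTop,
      ∀ x : ℝ, |x| ≤ R → |perturbedSum α f (μ k) x - h x| ≤ 1 / ((n : ℝ) + 1) := fun n => by
    refine frequently_atTop.2 fun M => ?_
    obtain ⟨_, hm, ⟨k, rfl⟩, hk⟩ := H h hc h0 R (1 / ((n : ℝ) + 1)) (by positivity) (μ M)
    exact ⟨k, hμ.le_iff_le.1 hm, hk⟩
  obtain ⟨φ, hφ, hφ'⟩ := extraction_forall_of_frequently h1
  refine ⟨μ ∘ φ, hμ.comp hφ, fun n => ⟨φ n, rfl⟩, Metric.tendstoUniformlyOn_iff.2 fun ε hε => ?_⟩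
  filter_upwards [tendsto_one_div_add_atTop_nhds_zero_nat.eventually_lt_const hε] with n hn x hx
  rw [dist_comm, Real.dist_eq]
  exact (hφ' n x (hR x hx)).trans_lt hn

theorem feketeUniversal_eq_generalizedUniversalSeries {μ : ℕ → ℕ} (hμ : StrictMono μ)
    (α : ℕ → ℕ → ℝ) : feketeUniversal μ α = generalizedUniversalSeries μ α := by
  refine Set.Subset.antisymm (fun f hf h => ?_) fun f hf => ?_
  · have h1 : ∀ n : ℕ, ∃ m, ∀ x : ℝ, |x| ≤ n →
        |perturbedSum α f (μ m) x - h.1 x| < 1 / ((n : ℝ) + 1) := fun n => by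
      obtain ⟨lam, -, hlam, hu⟩ := hf h.1 h.1.continuous h.2 (Set.Icc (-n) n) isCompact_Icc
      obtain ⟨j, hj⟩ := (Metric.tendstoUniformlyOn_iff.1 hu (1 / ((n : ℝ) + 1))
        (by positivity)).exists
      obtain ⟨m, hm⟩ := hlam j
      refine ⟨m, fun x hx => ?_⟩
      rw [hm, ← Real.dist_eq, dist_comm]
      exact hj x (abs_le.1 hx)
    choose m hm using h1
    refine mem_closure_of_tendsto (b := atTop) (f := fun n => perturbedSumC α f (μ (m n))) ?_
      (Eventually.of_forall fun n => ⟨m n, rfl⟩)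
    rw [tendsto_subtype_rng, ContinuousMap.tendsto_iff_forall_isCompact_tendstoUniformlyOn]
    intro K hK
    obtain ⟨R, hR⟩ := hK.isBounded.exists_norm_le
    refine Metric.tendstoUniformlyOn_iff.2 fun ε hε => ?_
    filter_upwards [tendsto_one_div_add_atTop_nhds_zero_nat.eventually_lt_const hε,
      tendsto_natCast_atTop_atTop.eventually_ge_atTop R] with n hn hnR x hx
    rw [dist_comm, Real.dist_eq]
    exact (hm n x ((hR x hx).trans hnR)).trans hn
  · refine mem_feketeUniversal_of_forall_exists hμ fun h hc h0 R ε hε M => ?_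
    -- `C_0(ℝ)` has no isolated points, so the sums remain dense after finitely many are discarded.
    -- This forces arbitrarily large indices.
    have : Nontrivial vanishingAtZero := ⟨⟨⟨ContinuousMap.id ℝ, rfl⟩, 0, fun h => by
      have := DFunLike.congr_fun (congrArg Subtype.val h) (1 : ℝ)
      simp at this⟩⟩
    have hne : ∀ x : vanishingAtZero, (𝓝[≠] x).NeBot := Module.punctured_nhds_neBot ℝ _
    obtain ⟨_, ⟨⟨m, rfl⟩, hm⟩, hg⟩ := exists_mem_abs_sub_lt_of_dense
      (Dense.sdiff_finite hf ((Finset.range M).finite_toSet.image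
        fun n => perturbedSumC α f (μ n))) hc h0 R hε
    refine ⟨μ m, ?_, ⟨m, rfl⟩, fun x hx => (hg x hx).le⟩
    refine le_trans ?_ (hμ.le_apply (x := m))
    by_contra hlt
    exact hm ⟨m, by simpa using hlt, rfl⟩

/-- Density only has to be tested on countably many nonempty basic open sets, and meeting one of
them is an open condition on `f` because each perturbed sum depends continuously on `f`. -/
theorem isGδ_generalizedUniversalSeries (μ : ℕ → ℕ) (α : ℕ → ℕ → ℝ) :
    IsGδ (generalizedUniversalSeries μ α) := by
  have h1 : generalizedUniversalSeries μ α =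
      ⋂ o ∈ TopologicalSpace.countableBasis vanishingAtZero,
        ⋃ n, (fun f => perturbedSumC α f (μ n)) ⁻¹' o := by
    ext f
    change Dense (Set.range fun n => perturbedSumC α f (μ n)) ↔ _
    rw [(TopologicalSpace.isBasis_countableBasis vanishingAtZero).dense_iff]
    simp only [Set.mem_iInter, Set.mem_iUnion, Set.mem_preimage]
    refine forall₂_congr fun o ho => ⟨fun h => ?_, fun ⟨n, hn⟩ _ => ⟨_, hn, n, rfl⟩⟩
    obtain ⟨_, hx, n, rfl⟩ := h (TopologicalSpace.nonempty_of_mem_countableBasis ho)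
    exact ⟨n, hx⟩
  rw [h1]
  exact IsGδ.biInter (TopologicalSpace.countable_countableBasis _) fun o ho =>
    (isOpen_iUnion fun n => (TopologicalSpace.isOpen_of_mem_countableBasis ho).preimage
      (continuous_perturbedSumC α (μ n))).isGδ

/-! ### Universal combinations and the dense subspace -/

/-- Targets for a family of functions at stage `s`: one member of the family, determined by `s`,
is to follow a member of the sequence `t`, while the others follow `0`. -/
noncomputable def target (t : ℕ → vanishingAtZero) (s i : ℕ) : ℝ → ℝ :=
  if i = s.unpair.1.unpair.1 then (t s.unpair.1.unpair.2).1 else 0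

theorem continuous_target (t : ℕ → vanishingAtZero) (s i : ℕ) : Continuous (target t s i) := by
  unfold target
  split_ifs
  · exact ContinuousMap.continuous _
  · exact continuous_const

theorem target_zero (t : ℕ → vanishingAtZero) (s i : ℕ) : target t s i 0 = 0 := by
  unfold target
  split_ifs
  · exact (t _).2
  · rfl

/-- A nontrivial bounded combination of functions whose perturbed Taylor sums follow the targets
is universal. -/
theorem mem_feketeUniversal_of_combination {μ : ℕ → ℕ} (hμ : StrictMono μ) {α : ℕ → ℕ → ℝ}
    {t : ℕ → vanishingAtZero} (ht : DenseRange t) {lam : ℕ → ℕ} (hlam : StrictMono lam)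
    (hlamμ : ∀ s, lam s ∈ Set.range μ) {u : ℕ → SmoothFun}
    (hu : ∀ i s : ℕ, i ≤ s → ∀ x : ℝ, |x| ≤ s →
      |perturbedSum α (u i) (lam s) x - target t s i x| ≤ (1 / 2) ^ s)
    {f : SmoothFun} {c : ℕ → ℝ} {C : ℝ} (hc : ∀ i, |c i| ≤ C) {j : ℕ} (hj : c j ≠ 0)
    (hf : ∀ᶠ s in atTop, ∀ x, perturbedSum α f (lam s) x =
      ∑ i ∈ Finset.range (s + 1), c i * perturbedSum α (u i) (lam s) x) :
    f ∈ feketeUniversal μ α := by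
  refine mem_feketeUniversal_of_forall_exists hμ fun h hcont h0 R ε hε M => ?_
  obtain ⟨_, ⟨l, rfl⟩, hl⟩ := exists_mem_abs_sub_lt_of_dense ht (h := fun x => h x / c j)
    (hcont.div_const _) (by simp [h0]) R (ε := ε / 2 / |c j|) (by positivity)
  have hlim : Tendsto (fun s : ℕ => C * ((s : ℝ) * (1 / 2) ^ s + (1 / 2) ^ s)) atTop (𝓝 0) := by
    have := ((tendsto_self_mul_const_pow_of_lt_one (r := (1 / 2 : ℝ)) (by norm_num)
      (by norm_num)).add (tendsto_pow_atTop_nhds_zero_of_lt_one (r := (1 / 2 : ℝ)) (by norm_num)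
      (by norm_num))).const_mul C
    simpa using this
  obtain ⟨s₀, hs₀⟩ := eventually_atTop.1 (hf.and ((hlim.eventually_le_const (half_pos hε)).and
    (((eventually_ge_atTop j).and (eventually_ge_atTop M)).and
      (tendsto_natCast_atTop_atTop.eventually_ge_atTop R))))
  -- The last component of the code is free, so the request "`u j` follows `t l`" recurs at stages
  -- beyond any `s₀`.
  set s := Nat.pair (Nat.pair j l) s₀ with hs
  obtain ⟨hfs, hsmall, ⟨hsj, hsM⟩, hsR⟩ := hs₀ s (Nat.right_le_pair _ _)
  have hs1 : s.unpair.1.unpair.1 = j := by simp [hs]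
  have hs2 : s.unpair.1.unpair.2 = l := by simp [hs]
  refine ⟨lam s, hsM.trans hlam.le_apply, hlamμ s, fun x hx => ?_⟩
  have hT : ∑ i ∈ Finset.range (s + 1), c i * target t s i x = c j * (t l).1 x := by
    rw [Finset.sum_eq_single_of_mem j (Finset.mem_range.2 (Nat.lt_succ_of_le hsj))
      fun i _ hij => ?_]
    · rw [target, if_pos hs1.symm, hs2]
    · rw [target, if_neg (by rwa [hs1]), Pi.zero_apply, mul_zero]
  have hC0 : 0 ≤ C := (abs_nonneg _).trans (hc 0)
  have h1 : |perturbedSum α f (lam s) x - c j * (t l).1 x| ≤ ε / 2 := by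
    rw [hfs, ← hT, ← Finset.sum_sub_distrib]
    calc _ ≤ ∑ i ∈ Finset.range (s + 1),
          |c i * perturbedSum α (u i) (lam s) x - c i * target t s i x| :=
          Finset.abs_sum_le_sum_abs _ _
      _ ≤ ∑ _i ∈ Finset.range (s + 1), C * (1 / 2) ^ s := by
          refine Finset.sum_le_sum fun i hi => ?_
          rw [← mul_sub, abs_mul]
          exact mul_le_mul (hc i) (hu i s (Nat.lt_succ_iff.1 (Finset.mem_range.1 hi)) x
            (hx.trans hsR)) (abs_nonneg _) hC0
      _ = C * ((s : ℝ) * (1 / 2) ^ s + (1 / 2) ^ s) := by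
          simp only [Finset.sum_const, Finset.card_range, nsmul_eq_mul]
          push_cast
          ring
      _ ≤ ε / 2 := hsmall
  have h2 : |c j * (t l).1 x - h x| ≤ ε / 2 := by
    have : c j * (t l).1 x - h x = c j * ((t l).1 x - h x / c j) := by field_simp
    rw [this, abs_mul]
    calc _ ≤ |c j| * (ε / 2 / |c j|) := by gcongr; exact (hl x hx).le
      _ = ε / 2 := by field_simp
  calc _ = |(perturbedSum α f (lam s) x - c j * (t l).1 x) + (c j * (t l).1 x - h x)| := by
        congr 1; ring
    _ ≤ _ := abs_add_le _ _
    _ ≤ ε := by linarith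

theorem tendsto_zero_of_abs_derivAt_le {e : ℕ → SmoothFun}
    (he : ∀ i, ∀ k ≤ i, ∀ x, |derivAt k x (e i)| ≤ 2 * (1 / 2) ^ i) :
    Tendsto e atTop (𝓝 0) := by
  refine (withSeminorms_smoothSeminormFamily.tendsto_nhds e 0).2 fun n ε hε => ?_
  have hlim : Tendsto (fun i : ℕ => ((n : ℝ) + 1) * (2 * (1 / 2) ^ i)) atTop (𝓝 0) := by
    have := ((tendsto_pow_atTop_nhds_zero_of_lt_one (r := (1 / 2 : ℝ)) (by norm_num)
      (by norm_num)).const_mul 2).const_mul ((n : ℝ) + 1)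
    simpa using this
  filter_upwards [hlim.eventually_lt_const hε, eventually_ge_atTop n] with i hi hni
  rw [sub_zero]
  exact (smoothSeminorm_le fun k hk x _ => he i k (hk.trans hni) x).trans_lt hi

/-- There is a dense sequence of smooth functions all of whose nontrivial finite linear
combinations are universal. -/
theorem exists_denseRange_combinations_universal {μ : ℕ → ℕ} (hμ : StrictMono μ) {α : ℕ → ℕ → ℝ}
    (hα0 : ∀ n k : ℕ, k ≤ n → α n k ≠ 0)
    (hα : ∀ k : ℕ, ∃ l : ℝ, Tendsto (fun n => α n k) atTop (𝓝 l)) :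
    ∃ u : ℕ → SmoothFun, DenseRange u ∧
      ∀ c : ℕ →₀ ℝ, c ≠ 0 → c.sum (fun i a => a • u i) ∈ feketeUniversal μ α := by
  obtain ⟨t, ht⟩ := TopologicalSpace.exists_dense_seq vanishingAtZero
  obtain ⟨d, hd⟩ := TopologicalSpace.exists_dense_seq SmoothFun
  -- Unpairing repeats each `d l` infinitely often. Since `e i` tends to `0`, the corrected copies
  -- of `d l` converge to it, hence density.
  obtain ⟨lam, e, hlam, hlamμ, -, he, -, hfol⟩ := exists_perturbations_following hμ hα0 hα
    (fun i => d i.unpair.1) (target t) (continuous_target t) (target_zero t)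
  refine ⟨fun i => d i.unpair.1 + e i, ?_, fun c hc => ?_⟩
  · refine (hd.closure_eq ▸ closure_minimal ?_ isClosed_closure :
      Set.univ ⊆ closure (Set.range fun i => d i.unpair.1 + e i)) |> fun h f => h (Set.mem_univ f)
    rintro _ ⟨l, rfl⟩
    have h1 : Tendsto (fun n => d (Nat.pair l n).unpair.1 + e (Nat.pair l n)) atTop
        (𝓝 (d l + 0)) := by
      simp only [Nat.unpair_pair]
      exact tendsto_const_nhds.add ((tendsto_zero_of_abs_derivAt_le he).comp
        (tendsto_atTop_mono (Nat.right_le_pair l) tendsto_id))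
    rw [add_zero] at h1
    exact mem_closure_of_tendsto h1 (Eventually.of_forall fun n => ⟨Nat.pair l n, rfl⟩)
  · obtain ⟨j, hj⟩ := Finsupp.ne_iff.1 hc
    refine mem_feketeUniversal_of_combination hμ ht hlam hlamμ hfol
      (C := ∑ i ∈ c.support, |c i|) (fun i => ?_) hj ?_
    · by_cases hi : i ∈ c.support
      · exact Finset.single_le_sum (f := fun i => |c i|) (fun i _ => abs_nonneg _) hi
      · rw [Finsupp.notMem_support_iff.1 hi, abs_zero]
        exact Finset.sum_nonneg fun i _ => abs_nonneg _
    · filter_upwards [eventually_ge_atTop (c.support.sup id)] with s hs x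
      rw [← perturbedSumAt_apply, Finsupp.sum_of_support_subset c
        (s := Finset.range (s + 1)) (fun i hi => Finset.mem_range.2 (Nat.lt_succ_of_le
          ((Finset.le_sup (f := id) hi).trans hs))) _ (by simp), map_sum]
      simp only [map_smul, smul_eq_mul, perturbedSumAt_apply]

theorem dense_feketeUniversal {μ : ℕ → ℕ} (hμ : StrictMono μ) {α : ℕ → ℕ → ℝ}
    (hα0 : ∀ n k : ℕ, k ≤ n → α n k ≠ 0)
    (hα : ∀ k : ℕ, ∃ l : ℝ, Tendsto (fun n => α n k) atTop (𝓝 l)) :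
    Dense (feketeUniversal μ α) := by
  obtain ⟨u, hu, hc⟩ := exists_denseRange_combinations_universal hμ hα0 hα
  refine Dense.mono ?_ hu
  rintro _ ⟨i, rfl⟩
  simpa using hc (Finsupp.single i 1) (by simp)

theorem exists_dense_submodule_universal {μ : ℕ → ℕ} (hμ : StrictMono μ) {α : ℕ → ℕ → ℝ}
    (hα0 : ∀ n k : ℕ, k ≤ n → α n k ≠ 0)
    (hα : ∀ k : ℕ, ∃ l : ℝ, Tendsto (fun n => α n k) atTop (𝓝 l)) :
    ∃ D : Submodule ℝ SmoothFun, Dense (D : Set SmoothFun) ∧ ∀ f ∈ D, f ≠ 0 → f ∈ feketeUniversal μ α := by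
  obtain ⟨u, hu, hc⟩ := exists_denseRange_combinations_universal hμ hα0 hα
  refine ⟨Submodule.span ℝ (Set.range u), Dense.mono Submodule.subset_span hu, fun f hf hf0 => ?_⟩
  obtain ⟨c, rfl⟩ := Finsupp.mem_span_range_iff_exists_finsupp.1 hf
  exact hc c fun h => hf0 (by simp [h])

/-! ### The closed infinite-dimensional subspace -/

/-- Points of `[2, 4]` with pairwise disjoint smooth bumps around them. -/
theorem exists_points_bumps : ∃ (p : ℕ → ℝ) (v : ℕ → SmoothFun),
    (∀ i, 2 ≤ p i ∧ p i ≤ 4) ∧ (∀ i j, v i (p j) = if i = j then 1 else 0) ∧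
    (∀ i, ∀ x ≤ 2, v i x = 0) ∧ ∀ x, ∀ᶠ i in atTop, v i x = 0 := by
  -- The bump vanishes outside `(1, 2)`, so its dyadic rescalings about `2` live on the disjoint
  -- intervals `(2 + 2 ^ (-i), 2 + 2 ^ (1 - i))`.
  let b : ContDiffBump (3 / 2 : ℝ) := ⟨1 / 4, 1 / 2, by norm_num, by norm_num⟩
  have hbs : ContDiff ℝ ∞ (b : ℝ → ℝ) := b.contDiff
  have hlow : ∀ y ≤ 1, b y = 0 := fun y hy => b.zero_of_le_dist (by
    change 1 / 2 ≤ |y - 3 / 2|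
    rw [abs_of_nonpos (by linarith)]; linarith)
  have hhigh : ∀ y, 2 ≤ y → b y = 0 := fun y hy => b.zero_of_le_dist (by
    change 1 / 2 ≤ |y - 3 / 2|
    rw [abs_of_nonneg (by linarith)]; linarith)
  refine ⟨fun i => 2 + 3 / 2 / 2 ^ i, fun i => ⟨fun x => b (2 ^ i * (x - 2)),
    hbs.comp (contDiff_const.mul (contDiff_id.sub contDiff_const))⟩, fun i => ⟨?_, ?_⟩,
    fun i j => ?_, fun i x hx => ?_, fun x => ?_⟩
  · have : (0 : ℝ) ≤ 3 / 2 / 2 ^ i := by positivity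
    linarith
  · have : (3 / 2 / 2 ^ i : ℝ) ≤ 3 / 2 := div_le_self (by norm_num) (one_le_pow₀ (by norm_num))
    linarith
  · change b (2 ^ i * (2 + 3 / 2 / 2 ^ j - 2)) = _
    rw [add_sub_cancel_left]
    split_ifs with hij
    · subst hij
      rw [mul_div_cancel₀ _ (by positivity)]
      exact b.one_of_mem_closedBall (Metric.mem_closedBall_self b.rIn_pos.le)
    · rcases lt_or_gt_of_ne hij with h | h
      · refine hlow _ ?_
        have h2 : (2 : ℝ) ^ (i + 1) ≤ 2 ^ j := pow_le_pow_right₀ (by norm_num) h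
        rw [mul_div_assoc', div_le_one (by positivity)]
        rw [pow_succ] at h2
        have : (0 : ℝ) < 2 ^ i := by positivity
        linarith
      · refine hhigh _ ?_
        have h2 : (2 : ℝ) ^ (j + 1) ≤ 2 ^ i := pow_le_pow_right₀ (by norm_num) h
        rw [mul_div_assoc', le_div_iff₀ (by positivity)]
        rw [pow_succ] at h2
        have : (0 : ℝ) < 2 ^ j := by positivity
        linarith
  · refine hlow _ ?_
    have : (2 : ℝ) ^ i * (x - 2) ≤ 0 := mul_nonpos_of_nonneg_of_nonpos (by positivity) (by linarith)
    linarith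
  · rcases le_or_gt x 2 with hx | hx
    · refine Eventually.of_forall fun i => hlow _ ?_
      have : (2 : ℝ) ^ i * (x - 2) ≤ 0 :=
        mul_nonpos_of_nonneg_of_nonpos (by positivity) (by linarith)
      linarith
    · have h1 : Tendsto (fun i : ℕ => (2 : ℝ) ^ i * (x - 2)) atTop atTop :=
        (tendsto_pow_atTop_atTop_of_one_lt (by norm_num)).atTop_mul_const (by linarith)
      filter_upwards [h1.eventually_ge_atTop 2] with i hi
      exact hhigh _ hi

/-- The subspace of the smooth functions that are determined by their values at the points `p i`
through an interpolation series. -/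
noncomputable def interpolationSubmodule (p : ℕ → ℝ) (w : ℕ → SmoothFun)
    (hs : ∀ (f : SmoothFun) x, Summable fun i => f (p i) * w i x) : Submodule ℝ SmoothFun where
  carrier := {f | ∀ x, f x = ∑' i, f (p i) * w i x}
  zero_mem' x := by simp
  add_mem' {f g} hf hg x := by
    simp only [SmoothFun.add_apply, add_mul, (hs f x).tsum_add (hs g x)]
    rw [hf x, hg x]
  smul_mem' c f hf x := by
    simp only [SmoothFun.smul_apply, mul_assoc, tsum_mul_left]
    rw [hf x]

/-- For each `x` both sides of the interpolation identity are continuous in `f`: as the `p i` are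
bounded, one seminorm of `f` times `∑' i, |w i x|` dominates the series. -/
theorem isClosed_interpolationSubmodule {p : ℕ → ℝ} {w : ℕ → SmoothFun}
    (hs : ∀ (f : SmoothFun) x, Summable fun i => f (p i) * w i x) {n : ℕ} (hp : ∀ i, |p i| ≤ n)
    (hw : ∀ x, Summable fun i => |w i x|) :
    IsClosed (interpolationSubmodule p w hs : Set SmoothFun) := by
  have heq : (interpolationSubmodule p w hs : Set SmoothFun) =
      ⋂ x, {f | f x = ∑' i, f (p i) * w i x} := by
    ext f
    rw [Set.mem_iInter]
    rfl
  rw [heq]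
  refine isClosed_iInter fun x => isClosed_eq ?_ ?_
  · exact (continuous_derivAt 0 x).congr fun f => derivAt_zero_left x f
  · let φ : SmoothFun →ₗ[ℝ] ℝ :=
      { toFun := fun f => ∑' i, f (p i) * w i x
        map_add' := fun f g => by
          simp only [SmoothFun.add_apply, add_mul, (hs f x).tsum_add (hs g x)]
        map_smul' := fun c f => by
          simp only [SmoothFun.smul_apply, mul_assoc, tsum_mul_left, RingHom.id_apply,
            smul_eq_mul] }
    refine continuous_of_le_smoothSeminorm φ n (C := ∑' i, |w i x|)
      (tsum_nonneg fun i => abs_nonneg _) fun f => ?_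
    refine tsum_of_norm_bounded (f := fun i => f (p i) * w i x)
      ((hw x).hasSum.mul_right (smoothSeminorm n f)) fun i => ?_
    rw [Real.norm_eq_abs, abs_mul, mul_comm]
    refine mul_le_mul_of_nonneg_left ?_ (abs_nonneg _)
    simpa using abs_derivAt_le_smoothSeminorm (Nat.zero_le n) (hp i) f

theorem not_finiteDimensional_interpolationSubmodule {p : ℕ → ℝ} {w : ℕ → SmoothFun}
    (hs : ∀ (f : SmoothFun) x, Summable fun i => f (p i) * w i x)
    (hw : ∀ i j, w i (p j) = if i = j then 1 else 0) :
    ¬ FiniteDimensional ℝ (interpolationSubmodule p w hs) := by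
  intro hfin
  have hmem : ∀ j, w j ∈ interpolationSubmodule p w hs := fun j x => by
    simp [hw]
  have hli : LinearIndependent ℝ
      fun j => (⟨w j, hmem j⟩ : interpolationSubmodule p w hs) := by
    rw [linearIndependent_iff']
    intro s g hg i hi
    have h1 := congrArg (derivAt 0 (p i) ∘ₗ (interpolationSubmodule p w hs).subtype) hg
    simpa [hw, hi] using h1
  have := hli.finite
  exact not_finite ℕ

/-- The `e i` live in `[-1, 1]` and the bumps `v i` to the right of `2`. A member `f` has
coefficients `f (p i)`, bounded by a seminorm, and near `0` equals `∑ f (p i) e i`. The `e i` with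
`i > s` have no coefficients of order at most `lam s`, so the perturbed sum of index `lam s` is a
finite combination. -/
theorem exists_closed_submodule_universal {μ : ℕ → ℕ} (hμ : StrictMono μ) {α : ℕ → ℕ → ℝ}
    (hα0 : ∀ n k : ℕ, k ≤ n → α n k ≠ 0)
    (hα : ∀ k : ℕ, ∃ l : ℝ, Tendsto (fun n => α n k) atTop (𝓝 l)) :
    ∃ F : Submodule ℝ SmoothFun, IsClosed (F : Set SmoothFun) ∧ ¬ FiniteDimensional ℝ F ∧
      ∀ f ∈ F, f ≠ 0 → f ∈ feketeUniversal μ α := by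
  obtain ⟨t, ht⟩ := TopologicalSpace.exists_dense_seq vanishingAtZero
  obtain ⟨lam, e, hlam, hlamμ, hsupp, he, htay, hfol⟩ := exists_perturbations_following hμ hα0 hα
    (fun _ => 0) (target t) (continuous_target t) (target_zero t)
  simp only [zero_add] at hfol
  obtain ⟨p, v, hp, hvp, hv2, hvx⟩ := exists_points_bumps
  have hp4 : ∀ i, |p i| ≤ (4 : ℕ) := fun i => by
    rw [abs_of_nonneg (by linarith [hp i])]
    exact_mod_cast (hp i).2
  have hgeom : Summable fun i : ℕ => (2 : ℝ) * (1 / 2) ^ i := summable_geometric_two.mul_left 2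
  have hw : ∀ x, Summable fun i => |(e i + v i) x| := fun x => by
    refine Summable.of_norm_bounded_eventually_nat hgeom ?_
    filter_upwards [hvx x] with i hi
    rw [SmoothFun.add_apply, hi, add_zero, Real.norm_eq_abs, abs_abs]
    simpa using he i 0 (Nat.zero_le i) x
  have hfp : ∀ (f : SmoothFun) i, |f (p i)| ≤ smoothSeminorm 4 f := fun f i => by
    simpa using abs_derivAt_le_smoothSeminorm (Nat.zero_le 4) (hp4 i) f
  have hs : ∀ (f : SmoothFun) x, Summable fun i => f (p i) * (e i + v i) x := fun f x => by
    refine Summable.of_norm_bounded ((hw x).mul_left (smoothSeminorm 4 f)) fun i => ?_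
    rw [Real.norm_eq_abs, abs_mul]
    exact mul_le_mul_of_nonneg_right (hfp f i) (abs_nonneg _)
  refine ⟨interpolationSubmodule p (fun i => e i + v i) hs,
    isClosed_interpolationSubmodule hs hp4 hw,
    not_finiteDimensional_interpolationSubmodule hs fun i j => ?_, fun f hf hf0 => ?_⟩
  · rw [SmoothFun.add_apply, hvp, hsupp i (p j) (le_abs.2 (Or.inl (by linarith [hp j]))), zero_add]
  obtain ⟨j, hj⟩ : ∃ j, f (p j) ≠ 0 := by
    by_contra! hall
    refine hf0 (SmoothFun.ext fun x => ?_)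
    rw [hf x]
    simp [hall]
  obtain ⟨F, hF⟩ := exists_hasSum_derivAt (fun i => f (p i) • e i)
    (fun i k => exists_abs_derivAt_le (fun x hx => by
      rw [SmoothFun.smul_apply, hsupp i x hx, mul_zero]) k)
    fun k => ⟨fun i => smoothSeminorm 4 f * (2 * (1 / 2) ^ i), hgeom.mul_left _,
      (eventually_ge_atTop k).mono fun i hi x => by
        rw [map_smul, smul_eq_mul, abs_mul]
        exact mul_le_mul (hfp f i) (he i k hi x) (abs_nonneg _) (apply_nonneg _ _)⟩
  have hfF : ∀ᶠ x in 𝓝 (0 : ℝ), f x = F x := by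
    filter_upwards [eventually_le_nhds (show (0 : ℝ) < 2 by norm_num)] with x hx
    have h1 := hF 0 x
    simp only [derivAt_zero_left, SmoothFun.smul_apply] at h1
    rw [hf x, ← h1.tsum_eq]
    simp only [SmoothFun.add_apply, hv2 _ x hx, add_zero]
  refine mem_feketeUniversal_of_combination hμ ht hlam hlamμ hfol (hfp f) hj
    (Eventually.of_forall fun s x => ?_)
  have hcoeff : ∀ k ≤ lam s, taylorCoeff f k =
      taylorCoeff (∑ i ∈ Finset.range (s + 1), f (p i) • e i) k := fun k hk => by
    have h1 : HasSum (fun i => taylorCoeff (f (p i) • e i) k) (taylorCoeff f k) := by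
      rw [taylorCoeff_eq, derivAt_congr hfF]
      exact (hF k 0).div_const _
    rw [taylorCoeff_sum]
    refine h1.unique (hasSum_sum_of_ne_finset_zero fun i hi => ?_)
    rw [taylorCoeff_smul, htay i s (by simpa using hi) k hk, mul_zero]
  rw [perturbedSum_congr α hcoeff, ← perturbedSumAt_apply, map_sum]
  simp only [map_smul, smul_eq_mul, perturbedSumAt_apply]

end GenFekete

theorem theorem3p1 (μ : ℕ → ℕ) (hμ : StrictMono μ) (α : ℕ → ℕ → ℝ)
    (hα0 : ∀ n k : ℕ, k ≤ n → α n k ≠ 0)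
    (hα : ∀ k : ℕ, ∃ l : ℝ, Tendsto (fun n => α n k) atTop (𝓝 l)) :
    -- existence of a universal function
    (∃ f : ℝ → ℝ, ContDiff ℝ ∞ f ∧
      ∀ h : ℝ → ℝ, Continuous h → h 0 = 0 → ∀ K : Set ℝ, IsCompact K →
        ∃ lam : ℕ → ℕ, StrictMono lam ∧ (∀ n, lam n ∈ Set.range μ) ∧
          TendstoUniformlyOn
            (fun n x => ∑ k ∈ Finset.range (lam n + 1),
              iteratedDeriv k f 0 / (k.factorial : ℝ) * α (lam n) k * x ^ (k + 1))
            h atTop K) ∧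
    -- such functions are exactly the `μ`-generalized universal series
    GenFekete.feketeUniversal μ α = GenFekete.generalizedUniversalSeries μ α ∧
    -- they form a dense `G_δ` set
    Dense (GenFekete.feketeUniversal μ α) ∧ IsGδ (GenFekete.feketeUniversal μ α) ∧
    -- which contains, apart from `0`, a dense subspace
    (∃ D : Submodule ℝ GenFekete.SmoothFun, Dense (D : Set GenFekete.SmoothFun) ∧
      ∀ f ∈ D, f ≠ 0 → f ∈ GenFekete.feketeUniversal μ α) ∧
    -- and, apart from `0`, an infinite dimensional closed subspace
    (∃ F : Submodule ℝ GenFekete.SmoothFun, IsClosed (F : Set GenFekete.SmoothFun) ∧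
      ¬ FiniteDimensional ℝ F ∧
      ∀ f ∈ F, f ≠ 0 → f ∈ GenFekete.feketeUniversal μ α) := by
  have hdense := GenFekete.dense_feketeUniversal hμ hα0 hα
  have heq := GenFekete.feketeUniversal_eq_generalizedUniversalSeries hμ α
  obtain ⟨f, hf⟩ := hdense.nonempty
  exact ⟨⟨f, f.contDiff, hf⟩, heq, hdense,
    heq ▸ GenFekete.isGδ_generalizedUniversalSeries μ α,
    GenFekete.exists_dense_submodule_universal hμ hα0 hα,
    GenFekete.exists_closed_submodule_universal hμ hα0 hα⟩
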